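/- Let $D=(V,A)$ be a finite digraph, with finite vertex set $V$ and finite arc multiset $A$ (loops and multiple arcs allowed). Let $B_D(q,y,z)\in\mathbb{Q}[q,y,z]$ be its $B$-polynomial, that is, the unique polynomial such that for every positive integer $q$, $$B_D(q,y,z)=\sum_{f:V\to\{1,\dots,q\}} y^{\#\{(u,v)\in A\,:\,f(v)>f(u)\}}\,z^{\#\{(u,v)\in A\,:\,f(v)<f(u)\}}.$$ (1) If $D$ is acyclic (it has no directed cycle; in particular, no loop), then $$B_D(-q,y,1)=(-1)^{|V|}\,y^{|A|}\,B_D\!\left(q,\frac1y,1\right).$$ (2) If the underlying multigraph of $D$ (obtained by replacing each arc $(u,v)$ by an edge $\{u,v\}$, keeping multiplicities) is a forest, i.e. has no cycles (in particular, no loops and no multiple edges), then $$B_D(-q,y,z)=(-1)^{|V|}\,(y+z-1)^{|A|}\,B_D\!\left(q,\frac{y}{y+z-1},\frac{z}{y+z-1}\right).$$ Both are identities of rational functions in $q,y,z$; equivalently, they hold for all $q,y,z$ in any field of characteristic zero, with $y\neq0$ in (1) and $y+z-1\neq0$ in (2). -/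

import Mathlib

/-- A digraph with vertex set `V` and arc set `A`. Arcs have their own identity, so loops and
multiple arcs are allowed. Finiteness of `V` and `A` is imposed where it is needed. -/
structure MultiDigraph (V A : Type*) where
  /-- The origin of an arc. -/
  origin : A → V
  /-- The target of an arc. -/
  target : A → V

namespace MultiDigraph

variable {V A : Type*}

/-- `D` is acyclic: it has no directed cycle, i.e. no vertex can be reached from itself by a
directed path with at least one arc (in particular, there are no loops). -/
def IsAcyclic (D : MultiDigraph V A) : Prop :=
  ∀ v : V, ¬ Relation.TransGen (fun u w => ∃ a, D.origin a = u ∧ D.target a = w) v v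

/-- The edge of the underlying multigraph that comes from the arc `a`. -/
def edge (D : MultiDigraph V A) (a : A) : Sym2 V :=
  s(D.origin a, D.target a)

/-- The underlying multigraph of `D` is a forest, i.e. has no cycle: there are no loops (cycles of
length one), no two distinct arcs with the same pair of endpoints (cycles of length two), and the
simple graph formed by the edges has no cycles (of length at least three). -/
structure UnderlyingIsForest (D : MultiDigraph V A) : Prop where
  no_loop : ∀ a, D.origin a ≠ D.target a
  no_parallel : Function.Injective D.edge
  no_cycle : (SimpleGraph.fromEdgeSet (Set.range D.edge)).IsAcyclic

/-- The number of ascents of a coloring `f`: arcs `(u, v)` with `f v > f u`. -/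
def numAscents [Fintype A] (D : MultiDigraph V A) {q : ℕ} (f : V → Fin q) : ℕ :=
  (Finset.univ.filter fun a => f (D.origin a) < f (D.target a)).card

/-- The number of descents of a coloring `f`: arcs `(u, v)` with `f v < f u`. -/
def numDescents [Fintype A] (D : MultiDigraph V A) {q : ℕ} (f : V → Fin q) : ℕ :=
  (Finset.univ.filter fun a => f (D.target a) < f (D.origin a)).card

/-- The defining property of the `B`-polynomial in the variables `q = X 0`, `y = X 1`, `z = X 2`:
substituting any positive integer for the first variable gives the generating polynomial of
colorings with `q` colors, counted by ascents and descents. -/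
def IsBPolynomial [Fintype V] [DecidableEq V] [Fintype A] (D : MultiDigraph V A)
    (P : MvPolynomial (Fin 3) ℚ) : Prop :=
  ∀ q : ℕ, 0 < q →
    MvPolynomial.bind₁ ![(q : MvPolynomial (Fin 3) ℚ), MvPolynomial.X 1, MvPolynomial.X 2] P =
      ∑ f : V → Fin q,
        MvPolynomial.X 1 ^ D.numAscents f * MvPolynomial.X 2 ^ D.numDescents f

theorem sum_colorings_eq [Fintype V] [DecidableEq V] [Fintype A] (D : MultiDigraph V A)
    {R : Type*} [CommRing R] (y z : R) (q : ℕ) :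
    ∑ f : V → Fin q, y ^ D.numAscents f * z ^ D.numDescents f =
      ∑ p ∈ Finset.range (Fintype.card V + 1), q.choose p •
        ∑ g : V → Fin p with Function.Surjective g,
          y ^ D.numAscents g * z ^ D.numDescents g := by
  classical
  set W : ℕ → R := fun p => ∑ g : V → Fin p with Function.Surjective g,
          y ^ D.numAscents g * z ^ D.numDescents g with hW
  have hW0 : ∀ p, Fintype.card V < p → W p = 0 := by
    intro p hp
    simp only [hW]
    apply Finset.sum_eq_zero
    intro g hg
    have := Fintype.card_le_of_surjective g (Finset.mem_filter.1 hg).2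
    simp at this
    omega
  have h1 : ∀ s : Finset (Fin q),
      ∑ f : V → Fin q with Finset.univ.image f = s,
        y ^ D.numAscents f * z ^ D.numDescents f = W s.card := by
    intro s
    symm
    simp only [hW]
    refine Finset.sum_bij (fun g _ => fun v => s.orderEmbOfFin rfl (g v)) ?_ ?_ ?_ ?_
    · intro g hg
      have hg := (Finset.mem_filter.1 hg).2
      simp only [Finset.mem_filter, Finset.mem_univ, true_and]
      ext c
      simp only [Finset.mem_image, Finset.mem_univ, true_and]
      constructor
      · rintro ⟨v, rfl⟩
        exact Finset.orderEmbOfFin_mem _ _ _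
      · intro hc
        have : c ∈ Set.range (s.orderEmbOfFin rfl) := by
          rw [Finset.range_orderEmbOfFin]; exact hc
        obtain ⟨i, rfl⟩ := this
        obtain ⟨v, rfl⟩ := hg i
        exact ⟨v, rfl⟩
    · intro g _ g' _ h
      funext v
      exact (s.orderEmbOfFin rfl).injective (congrFun h v)
    · intro f hf
      have hf := (Finset.mem_filter.1 hf).2
      have hmem : ∀ v, f v ∈ Set.range (s.orderEmbOfFin rfl) := by
        intro v
        rw [Finset.range_orderEmbOfFin, ← hf]
        simp
      choose g hg using hmem
      refine ⟨g, ?_, funext hg⟩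
      simp only [Finset.mem_filter, Finset.mem_univ, true_and]
      intro i
      have : s.orderEmbOfFin rfl i ∈ Finset.univ.image f := by
        rw [hf]; exact Finset.orderEmbOfFin_mem _ _ _
      obtain ⟨v, -, hv⟩ := Finset.mem_image.1 this
      exact ⟨v, (s.orderEmbOfFin rfl).injective (by rw [hg, hv])⟩
    · intro g _
      simp [numAscents, numDescents]
  calc ∑ f : V → Fin q, y ^ D.numAscents f * z ^ D.numDescents f
      = ∑ s : Finset (Fin q), W s.card := by
        rw [← Finset.sum_fiberwise (g := fun f : V → Fin q => Finset.univ.image f)]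
        exact Finset.sum_congr rfl fun s _ => h1 s
    _ = ∑ p ∈ Finset.range (q + 1), q.choose p • W p := by
        have := Finset.sum_powerset_apply_card W (x := (Finset.univ : Finset (Fin q)))
        simpa using this
    _ = ∑ p ∈ Finset.range (max q (Fintype.card V) + 1), q.choose p • W p := by
        apply Finset.sum_subset
        · intro p; simp only [Finset.mem_range]; omega
        · intro p _ hp
          rw [Nat.choose_eq_zero_of_lt (by simpa using hp), zero_smul]
    _ = ∑ p ∈ Finset.range (Fintype.card V + 1), q.choose p • W p := by
        symm
        apply Finset.sum_subset
        · intro p; simp only [Finset.mem_range]; omega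
        · intro p _ hp
          rw [hW0 p (by simpa using hp), smul_zero]

/-- There is exactly one polynomial with the defining property of the `B`-polynomial. -/
theorem existsUnique_isBPolynomial [Fintype V] [DecidableEq V] [Fintype A]
    (D : MultiDigraph V A) : ∃! P, D.IsBPolynomial P := by
  classical
  refine existsUnique_of_exists_of_unique ⟨∑ p ∈ Finset.range (Fintype.card V + 1),
    MvPolynomial.C ((p.factorial : ℚ)⁻¹) *
      (∏ i ∈ Finset.range p, (MvPolynomial.X 0 - (i : MvPolynomial (Fin 3) ℚ))) *
      ∑ g : V → Fin p with Function.Surjective g,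
        MvPolynomial.X 1 ^ D.numAscents g * MvPolynomial.X 2 ^ D.numDescents g, ?_⟩ ?_
  · intro q _
    rw [sum_colorings_eq]
    simp only [map_sum, map_mul, map_pow, map_prod, map_sub, map_natCast,
      MvPolynomial.bind₁_X_right, MvPolynomial.bind₁_C_right]
    refine Finset.sum_congr rfl fun p _ => ?_
    have key : MvPolynomial.C ((p.factorial : ℚ)⁻¹) *
        (∏ i ∈ Finset.range p, ((q : MvPolynomial (Fin 3) ℚ) - (i : MvPolynomial (Fin 3) ℚ)))
          = (q.choose p : MvPolynomial (Fin 3) ℚ) := by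
      have h2 : (∏ i ∈ Finset.range p, ((q : ℚ) - (i : ℚ))) = p.factorial * q.choose p := by
        rw [← Nat.cast_mul, ← Nat.descFactorial_eq_factorial_mul_choose,
          Nat.descFactorial_eq_prod_range, Nat.cast_prod]
        by_cases hpq : p ≤ q
        · refine Finset.prod_congr rfl fun i hi => ?_
          rw [Nat.cast_sub (by have := Finset.mem_range.1 hi; omega)]
        · rw [Finset.prod_eq_zero (Finset.mem_range.2 (not_le.1 hpq)) (sub_self _),
            Finset.prod_eq_zero (Finset.mem_range.2 (not_le.1 hpq)) (by simp)]
      have h3 := congrArg (MvPolynomial.C (σ := Fin 3)) h2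
      simp only [map_prod, map_sub, map_natCast, map_mul] at h3
      rw [h3, ← mul_assoc, ← map_natCast (MvPolynomial.C (σ := Fin 3) (R := ℚ)) p.factorial,
        ← map_mul, inv_mul_cancel₀ (by exact_mod_cast p.factorial_ne_zero), map_one, one_mul]
    rw [nsmul_eq_mul, ← key]
    simp
  · intro P Q hP hQ
    refine MvPolynomial.funext_set
      ![Set.range (fun n : ℕ => ((n + 1 : ℕ) : ℚ)), Set.univ, Set.univ] ?_ ?_
    · intro i
      fin_cases i
      · exact Set.infinite_range_of_injective fun a b h => by simpa using h
      · exact Set.infinite_univ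
      · exact Set.infinite_univ
    · intro x hx
      obtain ⟨n, hn⟩ : x 0 ∈ Set.range (fun n : ℕ => ((n + 1 : ℕ) : ℚ)) := hx 0 (Set.mem_univ _)
      have h := congrArg (MvPolynomial.eval x)
        ((hP (n + 1) n.succ_pos).trans (hQ (n + 1) n.succ_pos).symm)
      have e : ∀ R : MvPolynomial (Fin 3) ℚ, MvPolynomial.eval x (MvPolynomial.bind₁
          ![((n + 1 : ℕ) : MvPolynomial (Fin 3) ℚ), MvPolynomial.X 1, MvPolynomial.X 2] R) =
          MvPolynomial.eval x R := by
        intro R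
        change MvPolynomial.aeval x (MvPolynomial.bind₁ _ R) = MvPolynomial.aeval x R
        rw [MvPolynomial.aeval_bind₁]
        congr 2
        funext i
        fin_cases i
        · simpa using hn
        · simp
        · simp
      rwa [e, e] at h

/-- The `B`-polynomial of `D`, in the variables `q = X 0`, `y = X 1`, `z = X 2`. -/
noncomputable def bPoly [Fintype V] [DecidableEq V] [Fintype A] (D : MultiDigraph V A) :
    MvPolynomial (Fin 3) ℚ :=
  D.existsUnique_isBPolynomial.choose

theorem bPoly_spec [Fintype V] [DecidableEq V] [Fintype A] (D : MultiDigraph V A) :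
    D.IsBPolynomial D.bPoly :=
  D.existsUnique_isBPolynomial.choose_spec.1

/-- The value `B_D(q, y, z)` at elements `q`, `y`, `z` of a field of characteristic zero. -/
noncomputable def B [Fintype V] [DecidableEq V] [Fintype A] (D : MultiDigraph V A)
    {K : Type*} [Field K] [CharZero K] (q y z : K) : K :=
  MvPolynomial.aeval ![q, y, z] D.bPoly

end MultiDigraph

/-! Write the factor `y`, `z` or `1` of an arc as `1 + (y - 1) [f u < f v] + (z - 1) [f v < f u]`.
Expanding the product over the arcs turns `B` into a combination of strict order polynomials of
partial reorientations of `D`, in which an arc is kept with coefficient `y - 1`, reversed with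
coefficient `z - 1`, or deleted. For `z = 1` nothing is reversed, and in a forest every
reorientation is acyclic, so in both cases Stanley's reciprocity applies to every term with nonzero
coefficient: up to the sign `(-1) ^ |V|`, `B(-q)` is the same combination of weak order polynomials.
Since `1 + (y - 1) [f u ≤ f v] + (z - 1) [f v ≤ f u]` is `t = y + z - 1` when `f u = f v`, that
combination counts colorings with weight `y`, `z` and `t` for ascents, descents and arcs with
endpoints of equal color. Dividing the weight of every arc by `t` gives `B(q, y / t, z / t)`. For
`z = 1` this is `B(q, 1, 1 / y)`, and reversing the order of the colors exchanges the last two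
arguments.

Reciprocity for order polynomials comes from removing the elements of lowest color: a strict map
takes its lowest value on an arbitrary set of minimal elements, while inclusion–exclusion over the
minimal elements gives for weak maps, up to sign, the same recurrence with the direction of `q`
reversed. -/

open Finset Polynomial

theorem exists_polynomial_antidifference (P : ℚ[X]) (c : ℚ) :
    ∃ Q : ℚ[X], Q.eval 0 = c ∧ ∀ x, Q.eval (x + 1) = Q.eval x + P.eval x := by
  suffices h : ∃ Q : ℚ[X], ∀ x, Q.eval (x + 1) = Q.eval x + P.eval x by
    obtain ⟨Q, hQ⟩ := h
    exact ⟨Q + C (c - Q.eval 0), by simp, fun x => by simp [hQ, add_right_comm]⟩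
  induction P using Polynomial.induction_on' with
  | add P₁ P₂ h₁ h₂ =>
    obtain ⟨Q₁, hQ₁⟩ := h₁
    obtain ⟨Q₂, hQ₂⟩ := h₂
    exact ⟨Q₁ + Q₂, fun x => by simp only [eval_add, hQ₁, hQ₂]; ring⟩
  | monomial n a =>
    refine ⟨C (a / (n + 1)) * Polynomial.bernoulli (n + 1), fun x => ?_⟩
    have hn : (n + 1 : ℚ) ≠ 0 := n.cast_add_one_ne_zero
    simp only [eval_mul, eval_C, eval_monomial, add_comm x 1, bernoulli_eval_one_add,
      Nat.cast_add_one, add_tsub_cancel_right]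
    field_simp

theorem sum_signType {M : Type*} [AddCommMonoid M] (g : SignType → M) :
    ∑ i, g i = g 0 + g 1 + g (-1) := by
  rw [SignType.univ_eq]
  simp [add_assoc, add_comm (g 1)]

theorem polynomial_eq_of_eval_natCast_eq {R : Type*} [CommRing R] [IsDomain R] [CharZero R]
    {P Q : R[X]} (h : ∀ q : ℕ, 0 < q → P.eval (q : R) = Q.eval (q : R)) : P = Q := by
  refine eq_of_infinite_eval_eq P Q
    (Set.Infinite.mono ?_ ((Set.Ioi_infinite 0).image Nat.cast_injective.injOn))
  rintro _ ⟨q, hq, rfl⟩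
  exact h q hq

theorem wellFounded_of_not_transGen_self {V : Type*} [Finite V] {r : V → V → Prop}
    (hr : ∀ v, ¬ Relation.TransGen r v v) : WellFounded r := by
  have : Std.Irrefl (Relation.TransGen r) := ⟨hr⟩
  exact Subrelation.wf Relation.TransGen.single
    (Finite.wellFounded_of_trans_of_irrefl (Relation.TransGen r))

theorem exists_walk_darts_of_reflTransGen {V : Type*} {G : SimpleGraph V} {r : V → V → Prop}
    (hr : ∀ u v, r u v → G.Adj u v) {u v : V} (h : Relation.ReflTransGen r u v) :
    ∃ p : G.Walk u v, ∀ d ∈ p.darts, r d.fst d.snd := by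
  induction h using Relation.ReflTransGen.head_induction_on with
  | refl => exact ⟨.nil, by simp⟩
  | head huw _ ih =>
    obtain ⟨p, hp⟩ := ih
    exact ⟨.cons (hr _ _ huw) p, by simpa [huw] using hp⟩

-- The directed path closing a cycle through `r v u` must be the edge `u v` itself.
theorem not_transGen_self_of_isAcyclic {V : Type*} {G : SimpleGraph V} (hG : G.IsAcyclic)
    {r : V → V → Prop} (hr : ∀ u v, r u v → G.Adj u v) (hasymm : ∀ u v, r u v → ¬ r v u)
    (v : V) : ¬ Relation.TransGen r v v := by
  classical
  intro hv
  obtain ⟨u, hvu, huv⟩ := Relation.TransGen.head'_iff.1 hv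
  obtain ⟨p, hp⟩ := exists_walk_darts_of_reflTransGen hr huv
  have hadj : G.Adj u v := (hr v u hvu).symm
  have hpath : p.bypass = hadj.toWalk := congrArg Subtype.val
    ((hG.subsingleton_path u v).elim p.toPath (.singleton hadj))
  refine hasymm v u hvu (hp ⟨(u, v), hadj⟩ (p.darts_bypass_subset_darts ?_))
  simp [hpath]

section OrderPolynomial

variable {V : Type*}

open Classical in
/-- The elements of `S` that are minimal in `S` for the relation `r`. -/
noncomputable def minimalElements (r : V → V → Prop) (S : Finset V) : Finset V :=
  {v ∈ S | ∀ u ∈ S, ¬ r u v}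

theorem mem_minimalElements {r : V → V → Prop} {S : Finset V} {v : V} :
    v ∈ minimalElements r S ↔ v ∈ S ∧ ∀ u ∈ S, ¬ r u v := by
  simp [minimalElements]

theorem minimalElements_subset {r : V → V → Prop} {S : Finset V} :
    minimalElements r S ⊆ S :=
  fun _ hv => (mem_minimalElements.1 hv).1

variable [DecidableEq V]

/-- The recurrence for `b` is the one for `a` read at negative arguments, so that `a S q` and
`b S q` are the values at `q` and `-q` of a single solution of one difference equation. -/
theorem exists_polynomial_of_powerset_recurrence {M : Finset V → Finset V} (hM : ∀ S, M S ⊆ S)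
    {a b : Finset V → ℕ → ℚ} (hab : ∀ S, a S 0 = b S 0)
    (ha : ∀ S q, a S (q + 1) = ∑ U ∈ (M S).powerset, a (S \ U) q)
    (hb : ∀ S q, b S q = ∑ U ∈ (M S).powerset, b (S \ U) (q + 1)) (S : Finset V) :
    ∃ P : ℚ[X], ∀ q : ℕ, P.eval (q : ℚ) = a S q ∧ P.eval (-(q : ℚ)) = b S q := by
  induction S using Finset.strongInduction with
  | H S ih =>
    have hsub : ∀ U ∈ (M S).powerset.erase ∅, S \ U ⊂ S := fun U hU => by
      obtain ⟨hU₀, hU⟩ := mem_erase.1 hU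
      exact sdiff_ssubset ((mem_powerset.1 hU).trans (hM S)) (nonempty_iff_ne_empty.2 hU₀)
    choose! P hP using ih
    obtain ⟨Q, hQ₀, hQ⟩ := exists_polynomial_antidifference
      (∑ U ∈ (M S).powerset.erase ∅, P (S \ U)) (a S 0)
    have split (g : Finset V → ℚ) : ∑ U ∈ (M S).powerset, g (S \ U) =
        g S + ∑ U ∈ (M S).powerset.erase ∅, g (S \ U) := by
      rw [← add_sum_erase _ _ (empty_mem_powerset (M S)), sdiff_empty]
    refine ⟨Q, fun q => ?_⟩
    induction q with
    | zero => simp [hQ₀, hab]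
    | succ q ihq =>
      constructor
      · rw [ha, split (a · q), Nat.cast_add_one, hQ, ihq.1, eval_finsetSum]
        exact congrArg _ (sum_congr rfl fun U hU => (hP _ (hsub U hU) q).1)
      · have hstep := hQ (-((q + 1 : ℕ) : ℚ))
        rw [eval_finsetSum, sum_congr rfl fun U hU => (hP _ (hsub U hU) (q + 1)).2,
          show -((q + 1 : ℕ) : ℚ) + 1 = -q by push_cast; ring, ihq.2, hb,
          split (b · (q + 1))] at hstep
        exact (add_right_cancel hstep).symm

variable [Fintype V]

open Classical in
/-- The maps `f : S → {0, …, q - 1}` with `R (f u) (f v)` whenever `r u v`; for `R` equal to `<`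
and `≤` these are the strict and the weak order-preserving maps. Each map is encoded by its
extension by zero, so that a map vanishing on `U ⊆ S` is also a map on `S \ U`. -/
noncomputable def orderMaps (R : ℕ → ℕ → Prop) (r : V → V → Prop) (q : ℕ) (S : Finset V) :
    Finset (V → ℕ) :=
  {f ∈ Fintype.piFinset fun v => if v ∈ S then range q else {0} |
    ∀ u ∈ S, ∀ v ∈ S, r u v → R (f u) (f v)}

variable {R : ℕ → ℕ → Prop} {r : V → V → Prop} {q : ℕ} {S U : Finset V} {f : V → ℕ}

theorem mem_orderMaps : f ∈ orderMaps R r q S ↔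
    (∀ v ∈ S, f v < q) ∧ (∀ v ∉ S, f v = 0) ∧ ∀ u ∈ S, ∀ v ∈ S, r u v → R (f u) (f v) := by
  have hpi : (∀ v, f v ∈ if v ∈ S then range q else {0}) ↔
      (∀ v ∈ S, f v < q) ∧ ∀ v ∉ S, f v = 0 := by
    rw [← forall_and]
    refine forall_congr' fun v => ?_
    by_cases hv : v ∈ S <;> simp [hv]
  simp only [orderMaps, mem_filter, Fintype.mem_piFinset, hpi, and_assoc]

theorem card_orderMaps_zero :
    #(orderMaps R r 0 S) = if S = ∅ then 1 else 0 := by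
  obtain rfl | ⟨v, hv⟩ := S.eq_empty_or_nonempty
  · simp [orderMaps]
  · rw [if_neg (ne_empty_of_mem hv), card_eq_zero]
    exact eq_empty_of_forall_notMem fun f hf => absurd ((mem_orderMaps.1 hf).1 v hv) (by simp)

theorem card_orderMaps_univ [DecidablePred fun f : V → Fin q => ∀ u v, r u v → R (f u) (f v)] :
    #(orderMaps R r q univ) = #{f : V → Fin q | ∀ u v, r u v → R (f u) (f v)} := by
  symm
  refine card_bij (fun f _ v => f v) (fun f hf => ?_) (fun f _ g _ hfg => ?_) fun f hf => ?_
  · simpa [mem_orderMaps] using hf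
  · exact funext fun v => Fin.ext (congrFun hfg v)
  · have hf := mem_orderMaps.1 hf
    exact ⟨fun v => ⟨f v, hf.1 v (mem_univ v)⟩, by simpa using hf.2.2, rfl⟩

theorem card_filter_ne_zero_orderMaps (hR : ∀ a b, R (a + 1) (b + 1) ↔ R a b) :
    #{f ∈ orderMaps R r (q + 1) S | ∀ v ∈ S, f v ≠ 0} = #(orderMaps R r q S) := by
  refine card_nbij' (fun f v => f v - 1) (fun f v => if v ∈ S then f v + 1 else 0) ?_ ?_ ?_ ?_
  · intro f hf
    simp only [coe_filter, Set.mem_ofPred_eq, mem_orderMaps, mem_coe] at hf ⊢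
    obtain ⟨⟨hlt, hzero, hord⟩, hne⟩ := hf
    refine ⟨fun v hv => ?_, fun v hv => by simp [hzero v hv], fun u hu v hv huv => ?_⟩
    · have := hlt v hv
      have := hne v hv
      omega
    · rw [← hR, Nat.sub_add_cancel (Nat.one_le_iff_ne_zero.2 (hne u hu)),
        Nat.sub_add_cancel (Nat.one_le_iff_ne_zero.2 (hne v hv))]
      exact hord u hu v hv huv
  · intro f hf
    simp only [coe_filter, Set.mem_ofPred_eq, mem_orderMaps, mem_coe] at hf ⊢
    exact ⟨⟨fun v hv => by simp [hv, hf.1 v hv], fun v hv => if_neg hv,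
      fun u hu v hv huv => by simpa [hu, hv, hR] using hf.2.2 u hu v hv huv⟩,
      fun v hv => by simp [hv]⟩
  · intro f hf
    simp only [coe_filter, Set.mem_ofPred_eq, mem_orderMaps] at hf
    funext v
    by_cases hv : v ∈ S
    · simp [hv, Nat.sub_add_cancel (Nat.one_le_iff_ne_zero.2 (hf.2 v hv))]
    · simp [hv, hf.1.2.1 v hv]
  · intro f hf
    rw [mem_coe, mem_orderMaps] at hf
    funext v
    by_cases hv : v ∈ S
    · simp [hv]
    · simp [hv, hf.2.1 v hv]

theorem filter_orderMaps_lt_eq (hU : U ⊆ minimalElements r S) :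
    {f ∈ orderMaps (· < ·) r (q + 1) S | {v ∈ S | f v = 0} = U} =
      {f ∈ orderMaps (· < ·) r (q + 1) (S \ U) | ∀ v ∈ S \ U, f v ≠ 0} := by
  ext f
  simp only [mem_filter, mem_orderMaps, mem_sdiff]
  constructor
  · rintro ⟨⟨hlt, hzero, hord⟩, rfl⟩
    simp only [mem_filter]
    exact ⟨⟨fun v hv => hlt v hv.1, fun v hv => by grind, fun u hu v hv => hord u hu.1 v hv.1⟩,
      by grind⟩
  · rintro ⟨⟨hlt, hzero, hord⟩, hne⟩
    have hUS := hU.trans minimalElements_subset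
    refine ⟨⟨fun v hv => ?_, fun v hv => hzero v fun h => hv h.1, fun u hu v hv huv => ?_⟩, ?_⟩
    · grind
    · have hvU : v ∉ U := fun hvU => (mem_minimalElements.1 (hU hvU)).2 u hu huv
      grind
    · grind

theorem card_orderMaps_lt_succ : #(orderMaps (· < ·) r (q + 1) S) =
    ∑ U ∈ (minimalElements r S).powerset, #(orderMaps (· < ·) r q (S \ U)) := by
  rw [card_eq_sum_card_fiberwise (f := fun f : V → ℕ => {v ∈ S | f v = 0})
    (t := (minimalElements r S).powerset)]
  · refine sum_congr rfl fun U hU => ?_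
    rw [filter_orderMaps_lt_eq (mem_powerset.1 hU),
      card_filter_ne_zero_orderMaps fun _ _ => Nat.add_lt_add_iff_right]
  · intro f hf
    simp only [mem_coe, mem_powerset, mem_orderMaps] at hf ⊢
    intro v hv
    rw [mem_filter] at hv
    refine mem_minimalElements.2 ⟨hv.1, fun u hu huv => ?_⟩
    have := hf.2.2 u hu v hv.1 huv
    omega

theorem orderMaps_le_sdiff (hU : U ⊆ minimalElements r S) :
    orderMaps (· ≤ ·) r (q + 1) (S \ U) =
      {f ∈ orderMaps (· ≤ ·) r (q + 1) S | U ⊆ {v ∈ minimalElements r S | f v = 0}} := by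
  ext f
  simp only [mem_filter, mem_orderMaps, mem_sdiff, subset_iff]
  constructor
  · rintro ⟨hlt, hzero, hord⟩
    refine ⟨⟨fun v hv => by grind, by grind, fun u hu v hv huv => ?_⟩, by grind⟩
    have hvU : v ∉ U := fun hvU => (mem_minimalElements.1 (hU hvU)).2 u hu huv
    grind
  · rintro ⟨⟨hlt, hzero, hord⟩, hne⟩
    exact ⟨by grind, by grind, by grind⟩

theorem filter_minimalElements_eq_empty_iff (hr : WellFounded r)
    (hf : f ∈ orderMaps (· ≤ ·) r q S) :
    {v ∈ minimalElements r S | f v = 0} = ∅ ↔ ∀ v ∈ S, f v ≠ 0 := by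
  refine ⟨fun h v => ?_, fun h => filter_eq_empty_iff.2 fun v hv =>
    h v (minimalElements_subset hv)⟩
  induction v using hr.induction with
  | _ v ih =>
    intro hv
    by_cases hmin : v ∈ minimalElements r S
    · exact filter_eq_empty_iff.1 h hmin
    · obtain ⟨u, hu, huv⟩ : ∃ u ∈ S, r u v := by simpa [mem_minimalElements, hv] using hmin
      have := ih u huv hu
      have := (mem_orderMaps.1 hf).2.2 u hu v hv huv
      omega

-- Inclusion–exclusion over the minimal elements on which a map takes its lowest value.
theorem card_orderMaps_le_eq_sum (hr : WellFounded r) :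
    (#(orderMaps (· ≤ ·) r q S) : ℤ) = ∑ U ∈ (minimalElements r S).powerset,
      (-1) ^ #U * (#(orderMaps (· ≤ ·) r (q + 1) (S \ U)) : ℤ) := by
  calc (#(orderMaps (· ≤ ·) r q S) : ℤ)
      = ∑ f ∈ orderMaps (· ≤ ·) r (q + 1) S, if ∀ v ∈ S, f v ≠ 0 then 1 else 0 := by
        rw [sum_boole, card_filter_ne_zero_orderMaps fun _ _ => Nat.add_le_add_iff_right]
    _ = ∑ f ∈ orderMaps (· ≤ ·) r (q + 1) S,
          ∑ U ∈ {v ∈ minimalElements r S | f v = 0}.powerset, (-1) ^ #U := by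
        refine sum_congr rfl fun f hf => ?_
        simp only [sum_powerset_neg_one_pow_card, filter_minimalElements_eq_empty_iff hr hf]
    _ = ∑ U ∈ (minimalElements r S).powerset, ∑ f ∈ orderMaps (· ≤ ·) r (q + 1) S
          with U ⊆ {v ∈ minimalElements r S | f v = 0}, (-1) ^ #U := by
        refine sum_comm' fun f U => ?_
        simp only [mem_powerset, mem_filter]
        exact ⟨fun h => ⟨h, h.2.trans (filter_subset _ _)⟩, And.left⟩
    _ = _ := by
        refine sum_congr rfl fun U hU => ?_
        rw [sum_const, nsmul_eq_mul, mul_comm, orderMaps_le_sdiff (mem_powerset.1 hU)]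

theorem signed_card_orderMaps_le_eq_sum (hr : WellFounded r) :
    (-1) ^ #S * (#(orderMaps (· ≤ ·) r q S) : ℤ) = ∑ U ∈ (minimalElements r S).powerset,
      (-1) ^ #(S \ U) * (#(orderMaps (· ≤ ·) r (q + 1) (S \ U)) : ℤ) := by
  rw [card_orderMaps_le_eq_sum hr, mul_sum]
  refine sum_congr rfl fun U hU => ?_
  have hUS : U ⊆ S := (mem_powerset.1 hU).trans minimalElements_subset
  rw [← card_sdiff_add_card_eq_card hUS, ← mul_assoc, pow_add, mul_assoc (_ ^ _),
    ← pow_add, Even.neg_one_pow ⟨#U, rfl⟩, mul_one]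

open Classical in
/-- Stanley's reciprocity theorem for order polynomials. -/
theorem exists_orderPolynomial (K : Type*) [CommRing K] [Algebra ℚ K] (hr : WellFounded r) :
    ∃ P : K[X], ∀ q : ℕ,
      P.eval (q : K) = #{f : V → Fin q | ∀ u v, r u v → f u < f v} ∧
      P.eval (-(q : K)) =
        (-1) ^ Fintype.card V * #{f : V → Fin q | ∀ u v, r u v → f u ≤ f v} := by
  obtain ⟨P, hP⟩ : ∃ P : ℚ[X], ∀ q : ℕ, P.eval (q : ℚ) = #(orderMaps (· < ·) r q univ) ∧
      P.eval (-(q : ℚ)) = (-1) ^ #(univ : Finset V) * #(orderMaps (· ≤ ·) r q univ) := by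
    refine exists_polynomial_of_powerset_recurrence
      (M := minimalElements r) (a := fun S q => #(orderMaps (· < ·) r q S))
      (b := fun S q => (-1) ^ #S * #(orderMaps (· ≤ ·) r q S))
      (fun _ => minimalElements_subset) (fun S => ?_) (fun S q => ?_) (fun S q => ?_) univ
    · simp only [card_orderMaps_zero]
      split_ifs with hS <;> simp [hS]
    · exact_mod_cast card_orderMaps_lt_succ
    · exact_mod_cast signed_card_orderMaps_le_eq_sum hr
  simp only [card_orderMaps_univ, card_univ, Fin.val_fin_lt, Fin.val_fin_le] at hP
  refine ⟨P.map (algebraMap ℚ K), fun q => ⟨?_, ?_⟩⟩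
  · simpa [(hP q).1] using eval_natCast_map (algebraMap ℚ K) P q
  · simpa [(hP q).2] using eval_intCast_map (algebraMap ℚ K) P (-q)

end OrderPolynomial

namespace MultiDigraph

variable {V A : Type*}

/-- The relation formed by a partial reorientation of `D`: arcs with sign `1` are kept, arcs with
sign `-1` are reversed, and arcs with sign `0` are deleted. -/
def orientation (D : MultiDigraph V A) (s : A → SignType) (u v : V) : Prop :=
  ∃ a, (s a = 1 ∧ D.origin a = u ∧ D.target a = v) ∨ (s a = -1 ∧ D.target a = u ∧ D.origin a = v)

theorem forall_orientation_iff {D : MultiDigraph V A} {s : A → SignType} {p : V → V → Prop} :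
    (∀ u v, D.orientation s u v → p u v) ↔
      ∀ a, (s a = 1 → p (D.origin a) (D.target a)) ∧ (s a = -1 → p (D.target a) (D.origin a)) := by
  constructor
  · exact fun h a => ⟨fun ha => h _ _ ⟨a, .inl ⟨ha, rfl, rfl⟩⟩,
      fun ha => h _ _ ⟨a, .inr ⟨ha, rfl, rfl⟩⟩⟩
  · rintro h u v ⟨a, ⟨ha, rfl, rfl⟩ | ⟨ha, rfl, rfl⟩⟩
    exacts [(h a).1 ha, (h a).2 ha]

theorem IsAcyclic.wellFounded_orientation [Finite V] {D : MultiDigraph V A} (hD : D.IsAcyclic)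
    {s : A → SignType} (hs : ∀ a, s a ≠ -1) : WellFounded (D.orientation s) := by
  refine Subrelation.wf (fun {u v} huv => ?_) (wellFounded_of_not_transGen_self hD)
  exact forall_orientation_iff (p := fun u w => ∃ a, D.origin a = u ∧ D.target a = w).2
    (fun a => ⟨fun _ => ⟨a, rfl, rfl⟩, fun ha => absurd ha (hs a)⟩) u v huv

theorem UnderlyingIsForest.not_orientation_symm {D : MultiDigraph V A}
    (hD : D.UnderlyingIsForest) {s : A → SignType} {u v : V} (huv : D.orientation s u v) :
    ¬ D.orientation s v u := by
  rintro ⟨b, hb⟩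
  obtain ⟨a, ha⟩ := huv
  obtain rfl : a = b := hD.no_parallel (by grind [edge, Sym2.eq_swap])
  have := hD.no_loop a
  have : (1 : SignType) ≠ -1 := by decide
  grind

theorem UnderlyingIsForest.wellFounded_orientation [Finite V] {D : MultiDigraph V A}
    (hD : D.UnderlyingIsForest) (s : A → SignType) : WellFounded (D.orientation s) := by
  refine wellFounded_of_not_transGen_self
    (not_transGen_self_of_isAcyclic hD.no_cycle ?_ fun _ _ => hD.not_orientation_symm)
  exact forall_orientation_iff.2 fun a =>
    ⟨fun _ => (SimpleGraph.fromEdgeSet_adj _).2 ⟨⟨a, rfl⟩, hD.no_loop a⟩,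
      fun _ => (SimpleGraph.fromEdgeSet_adj _).2 ⟨⟨a, Sym2.eq_swap⟩, (hD.no_loop a).symm⟩⟩

/-- The weight of a coloring in which each ascent counts `y`, each descent `z`, and each arc whose
endpoints have the same color `t`; it is the summand of the `B`-polynomial when `t = 1`. -/
def weight [Fintype A] {C R : Type*} [LinearOrder C] [CommMonoid R] (D : MultiDigraph V A)
    (y z t : R) (f : V → C) : R :=
  ∏ a, if f (D.origin a) < f (D.target a) then y
    else if f (D.target a) < f (D.origin a) then z else t

/-- The contribution of an arc of the given sign to the expansion of `MultiDigraph.weight` as a sum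
over partial reorientations. -/
def signCoeff {R : Type*} [Ring R] (y z : R) : SignType → R
  | .zero => 1
  | .pos => y - 1
  | .neg => z - 1

section Weight

variable [Fintype A] {C R : Type*} [LinearOrder C]

theorem weight_one [CommMonoid R] (D : MultiDigraph V A) (y z : R) {q : ℕ} (f : V → Fin q) :
    D.weight y z 1 f = y ^ D.numAscents f * z ^ D.numDescents f := by
  simp only [weight, numAscents, numDescents, ← prod_const, prod_filter]
  rw [← prod_mul_distrib]
  refine prod_congr rfl fun a _ => ?_
  split_ifs with h₁ h₂
  · exact absurd h₁ h₂.not_gt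
  all_goals simp

theorem weight_mul [CommMonoid R] (D : MultiDigraph V A) (c y z t : R) (f : V → C) :
    D.weight (c * y) (c * z) (c * t) f = c ^ Fintype.card A * D.weight y z t f := by
  simp only [weight, ← mul_ite, prod_mul_distrib, prod_const, card_univ]

theorem weight_rev [CommMonoid R] (D : MultiDigraph V A) (y z t : R) {q : ℕ} (f : V → Fin q) :
    D.weight y z t (fun v => (f v).rev) = D.weight z y t f := by
  refine prod_congr rfl fun a _ => ?_
  simp only [Fin.rev_lt_rev]
  split_ifs with h₁ h₂
  · exact absurd h₁ h₂.not_gt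
  all_goals rfl

theorem sum_weight_swap [Fintype V] [DecidableEq V] [CommSemiring R] (D : MultiDigraph V A)
    (y z t : R) (q : ℕ) :
    ∑ f : V → Fin q, D.weight y z t f = ∑ f : V → Fin q, D.weight z y t f := by
  rw [← (Equiv.piCongrRight fun _ : V => Fin.revPerm (n := q)).sum_comp]
  exact sum_congr rfl fun f _ => D.weight_rev y z t f

variable [CommRing R]

open Classical in
theorem prod_add_ite_eq_sum_orientation (D : MultiDigraph V A) (y z : R) (p : V → V → Prop) :
    ∏ a, (1 + (if p (D.origin a) (D.target a) then y - 1 else 0) +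
        if p (D.target a) (D.origin a) then z - 1 else 0) =
      ∑ s : A → SignType, (∏ a, signCoeff y z (s a)) *
        if ∀ u v, D.orientation s u v → p u v then 1 else 0 := by
  have hfactor (a : A) : (1 + (if p (D.origin a) (D.target a) then y - 1 else 0) +
      if p (D.target a) (D.origin a) then z - 1 else 0) = ∑ i : SignType, signCoeff y z i *
        if (i = 1 → p (D.origin a) (D.target a)) ∧ (i = -1 → p (D.target a) (D.origin a))
          then 1 else 0 := by
    simp [sum_signType, signCoeff]
  simp_rw [hfactor, prod_univ_sum, Fintype.piFinset_univ, prod_mul_distrib, prod_boole,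
    forall_orientation_iff, mem_univ, true_imp_iff]

open Classical in
theorem weight_one_eq_sum_orientation (D : MultiDigraph V A) (y z : R) (f : V → C) :
    D.weight y z 1 f = ∑ s : A → SignType, (∏ a, signCoeff y z (s a)) *
      if ∀ u v, D.orientation s u v → f u < f v then 1 else 0 := by
  rw [← D.prod_add_ite_eq_sum_orientation y z fun u v => f u < f v]
  refine prod_congr rfl fun a _ => ?_
  split_ifs with h₁ h₂
  · exact absurd h₁ h₂.not_gt
  all_goals ring

open Classical in
theorem weight_add_sub_one_eq_sum_orientation (D : MultiDigraph V A) (y z : R) (f : V → C) :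
    D.weight y z (y + z - 1) f = ∑ s : A → SignType, (∏ a, signCoeff y z (s a)) *
      if ∀ u v, D.orientation s u v → f u ≤ f v then 1 else 0 := by
  rw [← D.prod_add_ite_eq_sum_orientation y z fun u v => f u ≤ f v]
  refine prod_congr rfl fun a _ => ?_
  rcases lt_trichotomy (f (D.origin a)) (f (D.target a)) with h | h | h
  · simp [h, h.le, h.not_ge]
  · simp only [h, le_refl, lt_irrefl, if_true, if_false]
    ring
  · simp [h, h.le, h.not_ge, h.not_gt]

end Weight

variable [Fintype V] [DecidableEq V] [Fintype A] {K : Type*} [Field K] [CharZero K]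

theorem exists_polynomial_sum_weight (D : MultiDigraph V A) (y z : K)
    (hD : ∀ s : A → SignType, ∏ a, signCoeff y z (s a) ≠ 0 → WellFounded (D.orientation s)) :
    ∃ P : K[X], ∀ q : ℕ, P.eval (q : K) = ∑ f : V → Fin q, D.weight y z 1 f ∧
      P.eval (-(q : K)) =
        (-1) ^ Fintype.card V * ∑ f : V → Fin q, D.weight y z (y + z - 1) f := by
  classical
  choose! P hP using fun s hs => exists_orderPolynomial K (hD s hs)
  refine ⟨∑ s, C (∏ a, signCoeff y z (s a)) * P s, fun q => ⟨?_, ?_⟩⟩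
  · simp only [weight_one_eq_sum_orientation]
    rw [sum_comm, eval_finsetSum]
    refine sum_congr rfl fun s _ => ?_
    rw [eval_mul, eval_C, ← mul_sum]
    obtain hs | hs := eq_or_ne (∏ a, signCoeff y z (s a)) 0
    · rw [hs, zero_mul, zero_mul]
    · rw [(hP s hs q).1, ← sum_boole]
      congr!
  · simp only [weight_add_sub_one_eq_sum_orientation]
    rw [sum_comm, eval_finsetSum, mul_sum]
    refine sum_congr rfl fun s _ => ?_
    rw [eval_mul, eval_C, ← mul_sum, mul_left_comm]
    obtain hs | hs := eq_or_ne (∏ a, signCoeff y z (s a)) 0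
    · rw [hs, zero_mul, zero_mul]
    · rw [(hP s hs q).2, ← sum_boole]
      congr!

/-- The `B`-polynomial at fixed `y` and `z`, as a polynomial in `q`. -/
noncomputable def bPolyAt (D : MultiDigraph V A) (y z : K) : K[X] :=
  MvPolynomial.aeval ![X, C y, C z] D.bPoly

theorem eval_bPolyAt (D : MultiDigraph V A) (q y z : K) :
    (D.bPolyAt y z).eval q = D.B q y z := by
  unfold bPolyAt B
  have h := MvPolynomial.comp_aeval_apply (R := ℚ) ![X, C y, C z]
    ((Polynomial.aeval q : K[X] →ₐ[K] K).restrictScalars ℚ) D.bPoly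
  simp only [AlgHom.restrictScalars_apply, coe_aeval_eq_eval] at h
  rw [h]
  congr 2
  funext i
  fin_cases i <;> simp

theorem B_natCast (D : MultiDigraph V A) {q : ℕ} (hq : 0 < q) (y z : K) :
    D.B (q : K) y z = ∑ f : V → Fin q, D.weight y z 1 f := by
  have h := congrArg (MvPolynomial.aeval ![(q : K), y, z]) (D.bPoly_spec q hq)
  simp only [MvPolynomial.aeval_bind₁, map_sum, map_mul, map_pow, MvPolynomial.aeval_X] at h
  simp only [weight_one]
  refine Eq.trans ?_ h
  unfold B
  congr 2
  funext i
  fin_cases i <;> simp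

theorem B_swap (D : MultiDigraph V A) (q y z : K) : D.B q y z = D.B q z y := by
  have hpoly : D.bPolyAt y z = D.bPolyAt z y := polynomial_eq_of_eval_natCast_eq fun n hn => by
    rw [eval_bPolyAt, eval_bPolyAt, D.B_natCast hn, D.B_natCast hn, sum_weight_swap]
  rw [← eval_bPolyAt, hpoly, eval_bPolyAt]

theorem B_neg_natCast (D : MultiDigraph V A) (y z : K)
    (hD : ∀ s : A → SignType, ∏ a, signCoeff y z (s a) ≠ 0 → WellFounded (D.orientation s))
    (q : ℕ) : D.B (-(q : K)) y z =
      (-1) ^ Fintype.card V * ∑ f : V → Fin q, D.weight y z (y + z - 1) f := by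
  obtain ⟨P, hP⟩ := D.exists_polynomial_sum_weight y z hD
  have hpoly : D.bPolyAt y z = P := polynomial_eq_of_eval_natCast_eq fun n hn => by
    rw [eval_bPolyAt, D.B_natCast hn, (hP n).1]
  rw [← eval_bPolyAt, hpoly, (hP q).2]

theorem B_neg (D : MultiDigraph V A) (y z : K)
    (hD : ∀ s : A → SignType, ∏ a, signCoeff y z (s a) ≠ 0 → WellFounded (D.orientation s))
    (ht : y + z - 1 ≠ 0) (q : K) :
    D.B (-q) y z = (-1) ^ Fintype.card V * (y + z - 1) ^ Fintype.card A *
      D.B q (y / (y + z - 1)) (z / (y + z - 1)) := by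
  set t := y + z - 1 with ht_def
  have hscale {n : ℕ} (f : V → Fin n) :
      D.weight y z t f = t ^ Fintype.card A * D.weight (y / t) (z / t) 1 f := by
    rw [← weight_mul, mul_div_cancel₀ _ ht, mul_div_cancel₀ _ ht, mul_one]
  have hpoly : (D.bPolyAt y z).comp (-X) =
      C ((-1) ^ Fintype.card V * t ^ Fintype.card A) * D.bPolyAt (y / t) (z / t) := by
    refine polynomial_eq_of_eval_natCast_eq fun n hn => ?_
    simp only [eval_comp, eval_neg, eval_X, eval_mul, eval_C, eval_bPolyAt]
    rw [D.B_neg_natCast y z hD, D.B_natCast hn, mul_assoc, mul_sum (a := t ^ _), ← ht_def]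
    simp only [hscale]
  simpa [eval_comp, eval_bPolyAt] using congrArg (eval q) hpoly

end MultiDigraph

theorem theorem6p9 {V A : Type*} [Fintype V] [DecidableEq V] [Fintype A] (D : MultiDigraph V A)
    {K : Type*} [Field K] [CharZero K] :
    (D.IsAcyclic →
      ∀ q y : K, y ≠ 0 →
        D.B (-q) y 1 = (-1) ^ Fintype.card V * y ^ Fintype.card A * D.B q (1 / y) 1) ∧
    (D.UnderlyingIsForest →
      ∀ q y z : K, y + z - 1 ≠ 0 →
        D.B (-q) y z = (-1) ^ Fintype.card V * (y + z - 1) ^ Fintype.card A *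
          D.B q (y / (y + z - 1)) (z / (y + z - 1))) := by
  constructor
  · intro hD q y hy
    have hvanish (s : A → SignType) (hs : ∏ a, MultiDigraph.signCoeff y 1 (s a) ≠ 0) (a : A) :
        s a ≠ -1 := fun ha =>
      Finset.prod_ne_zero_iff.1 hs a (Finset.mem_univ a) (by rw [ha]; exact sub_self 1)
    have h := D.B_neg y 1 (fun s hs => hD.wellFounded_orientation (hvanish s hs))
      (by rwa [add_sub_cancel_right]) q
    rwa [add_sub_cancel_right, div_self hy, D.B_swap q] at h
  · exact fun hD q y z ht => D.B_neg y z (fun s _ => hD.wellFounded_orientation s) ht q
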